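/- Let $\mathbb Z_0=\mathbb Z\setminus\{0,1\}$, let $\delta\in[0,\pi/2)$, and let $(q_n)_{n\in\mathbb Z_0}$ be real numbers such that $q_n\ge c>0$ for all $n\in\mathbb Z_0$ and $q_n\to\infty$ as $|n|\to\infty$. Put $\rho_n=e^{2i\delta}$ for $n\le-1$ and $\rho_n=e^{-2i\delta}$ for $n\ge2$, and $\Delta y_n=y_{n+1}-y_n$. Consider the problem $$-\Delta^2y_{n-1}+q_ny_n=\lambda\rho_ny_n\quad(n\in\mathbb Z_0),\qquad y_{-1}=y_1,\quad \Delta y_{-1}=e^{2i\delta}\Delta y_1 .$$ Let $l_0^2$ be the Hilbert space of complex sequences $(y_n)_{n\in\mathbb Z_0}$ with $\sum_{n\in\mathbb Z_0}|y_n|^2<\infty$. Let $D$ be the set of $y\in l_0^2$ with $(q_ny_n)\in l_0^2$, let $L:D\to l_0^2$ be given by $(Ly)_n=-\Delta^2y_{n-1}+q_ny_n$, where $y_0$ and $y_1$ are determined by the conditions $y_{-1}=y_1$, $\Delta y_{-1}=e^{2i\delta}\Delta y_1$, and let $M:l_0^2\to l_0^2$ be the unitary operator $(My)_n=\rho_ny_n$.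 Let $A=M^{-1}L$ with domain $D$. Then $L$ and $A$ are invertible, with bounded inverses defined on all of $l_0^2$, and $A^{-1}=L^{-1}M$ is a completely continuous (compact) operator. Moreover the spectrum of the problem above, that is, the spectrum of $A$ (the set of $\lambda\in\mathbb C$ for which $A-\lambda I$ has no bounded inverse defined on the whole of $l_0^2$), is discrete: it is an at most countable set of eigenvalues of $A$ with no finite accumulation point. -/

import Mathlib

open Filter Topology

noncomputable section

namespace DiscreteNonHermitian

/-- The index set `ℤ ∖ {0, 1}`. -/
abbrev Z0 : Type := {n : ℤ // n ≠ 0 ∧ n ≠ 1}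

/-- The Hilbert space of square-summable complex sequences indexed by `ℤ ∖ {0, 1}`. -/
abbrev l20 : Type := lp (fun _ : Z0 => ℂ) 2

/-- `e^{2iδ}`. -/
def phase (δ : ℝ) : ℂ := Complex.exp (2 * Complex.I * δ)

/-- `ρ_n = e^{2iδ}` for `n ≤ -1` and `ρ_n = e^{-2iδ}` for `n ≥ 2`. -/
def rho (δ : ℝ) (n : Z0) : ℂ :=
  if (n : ℤ) ≤ -1 then Complex.exp (2 * Complex.I * δ) else Complex.exp (-(2 * Complex.I * δ))

/-- The extension to all of `ℤ` of a sequence on `ℤ ∖ {0, 1}` by the values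
`y_1 = y_{-1}` and `y_0 = y_{-1} + e^{2iδ} (y_2 - y_1)`, which are the only ones for which
`y_{-1} = y_1` and `Δ y_{-1} = e^{2iδ} Δ y_1` (see `extend_unique`). -/
def extend (δ : ℝ) (y : Z0 → ℂ) (n : ℤ) : ℂ :=
  if h : n ≠ 0 ∧ n ≠ 1 then y ⟨n, h⟩
  else if n = 0 then
    y ⟨-1, by decide⟩ + phase δ * (y ⟨2, by decide⟩ - y ⟨-1, by decide⟩)
  else y ⟨-1, by decide⟩

/-- The extension is characterised by agreeing with `y` on `ℤ ∖ {0, 1}` and satisfying the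
transition conditions. -/
theorem extend_unique (δ : ℝ) (y : Z0 → ℂ) (Y : ℤ → ℂ) :
    ((∀ n : Z0, Y n = y n) ∧ Y (-1) = Y 1 ∧
        fwdDiff 1 Y (-1) = Complex.exp (2 * Complex.I * δ) * fwdDiff 1 Y 1) ↔
      Y = extend δ y := by
  constructor
  · rintro ⟨h, h1, h2⟩
    have hm : Y (-1) = y ⟨-1, by decide⟩ := h ⟨-1, by decide⟩
    have h2' : Y 2 = y ⟨2, by decide⟩ := h ⟨2, by decide⟩
    funext n
    by_cases hn : n ≠ 0 ∧ n ≠ 1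
    · simp only [extend, hn, dif_pos, ne_eq, not_false_eq_true, and_self]
      exact h ⟨n, hn⟩
    · by_cases h0 : n = 0
      · subst h0
        simp only [fwdDiff, Int.reduceNeg, neg_add_cancel, one_add_one_eq_two] at h2
        rw [← h1, h2', hm] at h2
        simp only [extend, phase, ne_eq, not_true_eq_false, false_and, dif_neg,
          not_false_eq_true, if_true]
        linear_combination h2
      · have h1' : n = 1 := by by_contra h3; exact hn ⟨h0, h3⟩
        subst h1'
        simp [extend, ← h1, hm]
  · rintro rfl
    refine ⟨fun n => ?_, ?_, ?_⟩
    · simp only [extend]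
      rw [dif_pos n.2]
    · simp [extend]
    · simp [extend, fwdDiff, phase]

theorem extend_add (δ : ℝ) (y z : Z0 → ℂ) (n : ℤ) :
    extend δ (y + z) n = extend δ y n + extend δ z n := by
  unfold extend
  split_ifs <;> simp only [Pi.add_apply]
  ring

theorem extend_smul (δ : ℝ) (a : ℂ) (y : Z0 → ℂ) (n : ℤ) :
    extend δ (a • y) n = a * extend δ y n := by
  unfold extend
  split_ifs <;> simp only [Pi.smul_apply, smul_eq_mul]
  ring

theorem memℓp_two_iff {ι : Type*} (f : ι → ℂ) : Memℓp f 2 ↔ Summable fun i => ‖f i‖ ^ 2 := by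
  rw [memℓp_gen_iff (by norm_num)]
  simp

theorem extend_memℓp (δ : ℝ) {y : Z0 → ℂ} (hy : Memℓp y 2) : Memℓp (extend δ y) 2 := by
  rw [memℓp_two_iff] at hy ⊢
  have hs : ({n : ℤ | n ≠ 0 ∧ n ≠ 1}ᶜ : Set ℤ).Finite :=
    (Set.toFinite ({0, 1} : Set ℤ)).subset (by
      intro n hn
      simp only [Set.mem_compl_iff, Set.mem_ofPred_eq] at hn
      simp only [Set.mem_insert_iff, Set.mem_singleton_iff]
      tauto)
  refine (Set.Finite.summable_compl_iff
    (s := {n : ℤ | n ≠ 0 ∧ n ≠ 1}ᶜ) hs).1 ?_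
  rw [compl_compl]
  refine hy.congr fun n => ?_
  have h : extend δ y n.1 = y n := by
    unfold extend
    rw [dif_pos n.2]
  exact congrArg (fun z : ℂ => ‖z‖ ^ 2) h.symm

theorem memℓp_extend_shift (δ : ℝ) {y : Z0 → ℂ} (hy : Memℓp y 2) (k : ℤ) :
    Memℓp (fun n : Z0 => extend δ y (n + k)) 2 := by
  have h := extend_memℓp δ hy
  rw [memℓp_two_iff] at h ⊢
  exact h.comp_injective (i := fun n : Z0 => (n : ℤ) + k)
    ((add_left_injective k).comp Subtype.val_injective)

/-- The sequence `-Δ² y_{n-1} + q_n y_n`, `n ∈ ℤ ∖ {0, 1}`, where `y_0` and `y_1` are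
determined by the transition conditions. -/
def diffExpr (δ : ℝ) (q : Z0 → ℝ) (y : Z0 → ℂ) (n : Z0) : ℂ :=
  -(fwdDiff 1 (fwdDiff 1 (extend δ y)) ((n : ℤ) - 1)) + (q n : ℂ) * y n

theorem diffExpr_eq (δ : ℝ) (q : Z0 → ℝ) (y : Z0 → ℂ) (n : Z0) :
    diffExpr δ q y n =
      -(extend δ y (n + 1) - 2 * extend δ y (n + 0) + extend δ y (n + -1)) + (q n : ℂ) * y n := by
  simp only [diffExpr, fwdDiff]
  rw [show (n : ℤ) - 1 + 1 = n + 0 by ring, show (n : ℤ) + 0 + 1 = n + 1 by ring,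
    show (n : ℤ) - 1 = n + -1 by ring]
  ring

theorem diffExpr_memℓp (δ : ℝ) (q : Z0 → ℝ) {y : Z0 → ℂ} (hy : Memℓp y 2)
    (hqy : Memℓp (fun n => (q n : ℂ) * y n) 2) : Memℓp (diffExpr δ q y) 2 := by
  have h := ((((memℓp_extend_shift δ hy 1).sub
    ((memℓp_extend_shift δ hy 0).const_mul 2)).add (memℓp_extend_shift δ hy (-1))).neg).add hqy
  convert h using 1
  funext n
  rw [diffExpr_eq]
  rfl

/-- The domain `D` of all `y ∈ l²` with `(q_n y_n) ∈ l²`. -/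
def domL (q : Z0 → ℝ) : Submodule ℂ l20 where
  carrier := {y | Memℓp (fun n => (q n : ℂ) * y n) 2}
  zero_mem' := by
    have h : (fun n : Z0 => (q n : ℂ) * (0 : l20) n) = 0 := by
      funext n
      simp
    simpa only [Set.mem_ofPred_eq, h] using zero_memℓp
  add_mem' := by
    intro y z hy hz
    have h := Memℓp.add hy hz
    refine (congrArg (fun f => Memℓp f 2) ?_).mp h
    funext n
    simp [mul_add]
  smul_mem' := by
    intro a y hy
    have h := Memℓp.const_mul hy a
    refine (congrArg (fun f => Memℓp f 2) ?_).mp h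
    funext n
    simp [mul_left_comm]

/-- The operator `L` with domain `D`: `(L y)_n = -Δ² y_{n-1} + q_n y_n`, where `y_0` and `y_1`
are defined by the transition conditions. -/
def opL (δ : ℝ) (q : Z0 → ℝ) : l20 →ₗ.[ℂ] l20 where
  domain := domL q
  toFun :=
    { toFun := fun y => ⟨diffExpr δ q (y : l20), diffExpr_memℓp δ q (lp.memℓp (y : l20)) y.2⟩
      map_add' := by
        intro y z
        refine lp.ext ?_
        funext n
        change diffExpr δ q ((y : l20) + (z : l20) : l20) n =
          diffExpr δ q (y : l20) n + diffExpr δ q (z : l20) n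
        rw [diffExpr_eq, diffExpr_eq, diffExpr_eq, lp.coeFn_add, extend_add, extend_add,
          extend_add, Pi.add_apply]
        ring
      map_smul' := by
        intro a y
        refine lp.ext ?_
        funext n
        change diffExpr δ q (a • (y : l20) : l20) n = a * diffExpr δ q (y : l20) n
        rw [diffExpr_eq, diffExpr_eq, lp.coeFn_smul, extend_smul, extend_smul, extend_smul,
          Pi.smul_apply, smul_eq_mul]
        ring }

theorem norm_rho (δ : ℝ) (n : Z0) : ‖rho δ n‖ = 1 := by
  unfold rho
  split_ifs <;> simp [Complex.norm_exp]

theorem memℓp_of_norm_eq {y z : Z0 → ℂ} (hy : Memℓp y 2) (h : ∀ n, ‖z n‖ = ‖y n‖) :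
    Memℓp z 2 := by
  rw [memℓp_two_iff] at hy ⊢
  simpa only [h] using hy

/-- The unitary operator `(M y)_n = ρ_n y_n`; its inverse is multiplication by `ρ_n⁻¹`. -/
def opM (δ : ℝ) : l20 ≃ₗᵢ[ℂ] l20 where
  toFun y := ⟨fun n => rho δ n * y n,
    memℓp_of_norm_eq (lp.memℓp y) fun n => by rw [norm_mul, norm_rho, one_mul]⟩
  invFun y := ⟨fun n => (rho δ n)⁻¹ * y n,
    memℓp_of_norm_eq (lp.memℓp y) fun n => by rw [norm_mul, norm_inv, norm_rho, inv_one, one_mul]⟩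
  map_add' y z := by
    refine lp.ext (funext fun n => ?_)
    exact mul_add (rho δ n) (y n) (z n)
  map_smul' a y := by
    refine lp.ext (funext fun n => ?_)
    exact mul_left_comm (rho δ n) a (y n)
  left_inv y := by
    refine lp.ext (funext fun n => ?_)
    have h : rho δ n ≠ 0 := norm_ne_zero_iff.1 (by rw [norm_rho]; exact one_ne_zero)
    exact inv_mul_cancel_left₀ h (y n)
  right_inv y := by
    refine lp.ext (funext fun n => ?_)
    have h : rho δ n ≠ 0 := norm_ne_zero_iff.1 (by rw [norm_rho]; exact one_ne_zero)
    exact mul_inv_cancel_left₀ h (y n)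
  norm_map' y := by
    rw [lp.norm_eq_tsum_rpow (by norm_num), lp.norm_eq_tsum_rpow (by norm_num)]
    congr 1
    refine tsum_congr fun n => ?_
    congr 1
    change ‖rho δ n * y n‖ = ‖y n‖
    rw [norm_mul, norm_rho, one_mul]

/-- The operator `A = M⁻¹ L` with domain `D`. -/
def opA (δ : ℝ) (q : Z0 → ℝ) : l20 →ₗ.[ℂ] l20 :=
  ((opM δ).symm.toLinearEquiv : l20 →ₗ[ℂ] l20).compPMap (opL δ q)

section General

variable {E : Type*} [NormedAddCommGroup E] [NormedSpace ℂ E]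

/-- `B` is a bounded operator, defined on the whole space, which is the two-sided inverse of
the (not necessarily bounded or everywhere defined) operator `T`. -/
def IsBoundedInverse (T : E →ₗ.[ℂ] E) (B : E →L[ℂ] E) : Prop :=
  (∀ x : T.domain, B (T x) = x) ∧ ∀ y : E, ∃ h : B y ∈ T.domain, T ⟨B y, h⟩ = y

/-- The operator `T - μ I`, with the same domain as `T`. -/
def shift (T : E →ₗ.[ℂ] E) (μ : ℂ) : E →ₗ.[ℂ] E where
  domain := T.domain
  toFun := T.toFun - μ • T.domain.subtype

/-- `μ` is a regular point of `T`: the inverse of `T - μ I` exists and is a bounded operator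
defined on the whole space. -/
def IsRegularPoint (T : E →ₗ.[ℂ] E) (μ : ℂ) : Prop :=
  ∃ B : E →L[ℂ] E, IsBoundedInverse (shift T μ) B

/-- The spectrum of `T`: the set of all complex numbers that are not regular points of `T`. -/
def operatorSpectrum (T : E →ₗ.[ℂ] E) : Set ℂ := {μ | ¬ IsRegularPoint T μ}

/-- `μ` is an eigenvalue of `T`. -/
def IsEigenvalue (T : E →ₗ.[ℂ] E) (μ : ℂ) : Prop :=
  ∃ x : T.domain, (x : E) ≠ 0 ∧ T x = μ • (x : E)

/-- The spectrum of `T` is discrete: it is an at most countable set of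
eigenvalues of `T` with no finite point of accumulation. -/
def HasDiscreteSpectrum (T : E →ₗ.[ℂ] E) : Prop :=
  (∀ μ ∈ operatorSpectrum T, IsEigenvalue T μ) ∧ (operatorSpectrum T).Countable ∧
    ∀ z : ℂ, ¬ AccPt z (𝓟 (operatorSpectrum T))

end General

end DiscreteNonHermitian

end

open DiscreteNonHermitian

/-!
`L` is the sum of the bounded operator `-Δ²` and of multiplication by `q`, and the latter has
compact resolvent because `q_n → ∞`. By the Fredholm alternative, `L` therefore has a compact
inverse as soon as its kernel is trivial.

If `L y = 0` and `Y` is the extension of `y` to `ℤ`, the flux `ΔY_n · conj Y_n` increases along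
each of the half-lines `n ≤ -1` and `1 ≤ n` and tends to `0` at `±∞`, so it is nonnegative at `-1`
and nonpositive at `1`. The transition conditions multiply it by `e^{2iδ} ≠ -1`, so it vanishes
at both points, hence everywhere on the half-lines; then `Y` is constant on each of them, and
tends to `0`.

The spectrum of `A` consists of the inverses of the nonzero eigenvalues of the compact operator
`A⁻¹`, and only finitely many of these lie outside any given disc around `0`, by Riesz.
-/

namespace DiscreteNonHermitian

section CompactOperator

variable {𝕜 E : Type*} [NontriviallyNormedField 𝕜] [NormedAddCommGroup E] [NormedSpace 𝕜 E]

theorem exists_bounded_seq_one_le_norm_sub {V : ℕ → Submodule 𝕜 E} (hV : StrictMono V)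
    (hVc : ∀ n, IsClosed (V n : Set E)) :
    ∃ (R : ℝ) (u : ℕ → E), ∀ n, u n ∈ V (n + 1) ∧ ‖u n‖ ≤ R ∧ ∀ y ∈ V n, 1 ≤ ‖u n - y‖ := by
  obtain ⟨c, hc⟩ := NormedField.exists_one_lt_norm 𝕜
  have hex (n : ℕ) : ∃ u ∈ V (n + 1), ‖u‖ ≤ ‖c‖ + 1 ∧ ∀ y ∈ V n, 1 ≤ ‖u - y‖ := by
    have hclosed : IsClosed ((V n).comap (V (n + 1)).subtype : Set (V (n + 1))) :=
      (hVc n).preimage continuous_subtype_val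
    obtain ⟨x, hx, hxn⟩ := SetLike.exists_of_lt (hV n.lt_succ_self)
    obtain ⟨u, hu, hdist⟩ := riesz_lemma_of_norm_lt hc (lt_add_one ‖c‖) hclosed ⟨⟨x, hx⟩, hxn⟩
    exact ⟨u, u.2, hu, fun y hy => hdist ⟨y, hV.monotone n.le_succ hy⟩ hy⟩
  choose u hu using hex
  exact ⟨‖c‖ + 1, u, hu⟩

/-- The idea of Riesz: on almost orthogonal unit vectors of the steps of the flag, `K` takes
values which stay away from each other. -/
theorem not_isCompactOperator_of_strictMono {K : E →ₗ[𝕜] E} {V : ℕ → Submodule 𝕜 E}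
    (hV : StrictMono V) (hVc : ∀ n, IsClosed (V n : Set E)) (hKV : ∀ n, ∀ x ∈ V n, K x ∈ V n)
    {μ : ℕ → 𝕜} {r : ℝ} (hr : 0 < r) (hμ : ∀ n, r ≤ ‖μ n‖)
    (hKμ : ∀ n, ∀ x ∈ V (n + 1), K x - μ n • x ∈ V n) : ¬ IsCompactOperator K := by
  intro hK
  obtain ⟨R, u, hu⟩ := exists_bounded_seq_one_le_norm_sub hV hVc
  let v (n : ℕ) : E := (μ n)⁻¹ • u n
  have hμ0 (n : ℕ) : μ n ≠ 0 := norm_pos_iff.1 (hr.trans_le (hμ n))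
  have hvV (n : ℕ) : v n ∈ V (n + 1) := (V (n + 1)).smul_mem _ (hu n).1
  have hv (n : ℕ) : v n ∈ Metric.closedBall (0 : E) (r⁻¹ * R) := by
    rw [mem_closedBall_zero_iff, norm_smul, norm_inv]
    gcongr
    exacts [hμ n, (hu n).2.1]
  have hsep {m n : ℕ} (hmn : m < n) : 1 ≤ ‖K (v n) - K (v m)‖ := by
    have hmem : K (v m) - (K (v n) - μ n • v n) ∈ V n :=
      (V n).sub_mem (hKV n _ (hV.monotone hmn (hvV m))) (hKμ n _ (hvV n))
    calc
      1 ≤ ‖u n - (K (v m) - (K (v n) - μ n • v n))‖ := (hu n).2.2 _ hmem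
      _ = ‖K (v n) - K (v m)‖ := by rw [smul_inv_smul₀ (hμ0 n)]; congr 1; abel
  obtain ⟨C, hC, hKC⟩ := hK.image_closedBall_subset_compact (r⁻¹ * R)
  obtain ⟨_, -, φ, hφ, hlim⟩ := hC.tendsto_subseq fun n => hKC ⟨v n, hv n, rfl⟩
  obtain ⟨N, hN⟩ := Metric.cauchySeq_iff.1 hlim.cauchySeq 1 one_pos
  refine (hN (N + 1) N.le_succ N le_rfl).not_ge ?_
  rw [dist_eq_norm]
  exact hsep (hφ N.lt_succ_self)

theorem finite_setOf_hasEigenvalue_of_isCompactOperator [CompleteSpace 𝕜] {K : E →ₗ[𝕜] E}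
    (hK : IsCompactOperator K) {r : ℝ} (hr : 0 < r) :
    {μ | Module.End.HasEigenvalue K μ ∧ r ≤ ‖μ‖}.Finite := by
  by_contra hinf
  let μ := Set.Infinite.natEmbedding _ hinf
  choose x hx using fun n => (μ n).2.1.exists_hasEigenvector
  have hxK (n : ℕ) : K (x n) = (μ n : 𝕜) • x n := (hx n).apply_eq_smul
  have hli : LinearIndependent 𝕜 x :=
    Module.End.eigenvectors_linearIndependent' K (fun n => (μ n : 𝕜))
      (Subtype.val_injective.comp μ.injective) x hx
  let V (n : ℕ) : Submodule 𝕜 E := Submodule.span 𝕜 (x '' Set.Iio n)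
  have hmem {m n : ℕ} (hmn : m < n) : x m ∈ V n := Submodule.subset_span ⟨m, hmn, rfl⟩
  have hmono : Monotone V := fun m n hmn =>
    Submodule.span_mono (Set.image_mono (Set.Iio_subset_Iio hmn))
  have hV : StrictMono V := strictMono_nat_of_lt_succ fun n =>
    SetLike.lt_iff_le_and_exists.2
      ⟨hmono n.le_succ, x n, hmem n.lt_succ_self, hli.notMem_span_image (lt_irrefl n)⟩
  have hVc (n : ℕ) : IsClosed (V n : Set E) :=
    have := FiniteDimensional.span_of_finite 𝕜 ((Set.finite_Iio n).image x)
    (V n).closed_of_finiteDimensional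
  have hKV (n : ℕ) : V n ≤ (V n).comap K := by
    refine Submodule.span_le.2 ?_
    rintro _ ⟨m, hmn, rfl⟩
    exact Submodule.mem_comap.2 (hxK m ▸ (V n).smul_mem _ (hmem hmn))
  have hKμ (n : ℕ) : V (n + 1) ≤ (V n).comap (K - (μ n : 𝕜) • LinearMap.id) := by
    refine Submodule.span_le.2 ?_
    rintro _ ⟨m, hm, rfl⟩
    change K (x m) - (μ n : 𝕜) • x m ∈ V n
    rcases (Nat.lt_succ_iff.1 hm).lt_or_eq with hmn | rfl
    · exact (V n).sub_mem (hKV n (hmem hmn)) ((V n).smul_mem _ (hmem hmn))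
    · rw [hxK, sub_self]
      exact zero_mem _
  exact not_isCompactOperator_of_strictMono hV hVc hKV hr (fun n => (μ n).2.2) hKμ hK

theorem isUnit_one_add_of_isCompactOperator [CompleteSpace E] {S : E →L[𝕜] E}
    (hS : IsCompactOperator S) (hker : ∀ x, x + S x = 0 → x = 0) : IsUnit (1 + S) := by
  rcases hS.hasEigenvalue_or_mem_resolventSet (μ := -1) (neg_ne_zero.2 one_ne_zero) with
    heigen | hresolvent
  · obtain ⟨x, hx⟩ := heigen.exists_hasEigenvector
    have hSx : S x = (-1 : 𝕜) • x := hx.apply_eq_smul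
    exact absurd (hker x (by rw [hSx, neg_one_smul, add_neg_cancel])) hx.2
  · have hneg : -(algebraMap 𝕜 (E →L[𝕜] E) (-1) - S) = 1 + S := by
      rw [map_neg, map_one, neg_sub, sub_neg_eq_add, add_comm]
    exact hneg ▸ (spectrum.mem_resolventSet_iff.1 hresolvent).neg

end CompactOperator

section LinearPMap

variable {E : Type*} [NormedAddCommGroup E] [NormedSpace ℂ E] {T : E →ₗ.[ℂ] E} {K : E →L[ℂ] E}

theorem IsBoundedInverse.exists_apply_eq (hT : IsBoundedInverse T K) {x y : E} (h : K y = x) :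
    ∃ hx : x ∈ T.domain, T ⟨x, hx⟩ = y :=
  h ▸ hT.2 y

theorem shift_eq_vadd (T : E →ₗ.[ℂ] E) (μ : ℂ) :
    shift T μ = (-(μ • LinearMap.id) : E →ₗ[ℂ] E) +ᵥ T := by
  refine LinearPMap.ext rfl fun x hx _ => ?_
  change T ⟨x, hx⟩ - μ • x = -(μ • x) + T ⟨x, hx⟩
  exact sub_eq_neg_add _ _

theorem IsBoundedInverse.ne_zero_and_hasEigenvalue_inv (hT : IsBoundedInverse T K) {μ : ℂ}
    (hμ : IsEigenvalue T μ) : μ ≠ 0 ∧ Module.End.HasEigenvalue (K : E →ₗ[ℂ] E) μ⁻¹ := by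
  obtain ⟨x, hx0, hx⟩ := hμ
  have hKx : μ • K x = x := by rw [← map_smul, ← hx, hT.1]
  have hμ0 : μ ≠ 0 := by
    rintro rfl
    exact hx0 (by rw [← hKx, zero_smul])
  refine ⟨hμ0, Module.End.hasEigenvalue_of_hasEigenvector ⟨?_, hx0⟩⟩
  exact Module.End.mem_eigenspace_iff.2 ((eq_inv_smul_iff₀ hμ0).2 hKx)

variable [CompleteSpace E]

/-- Applying `K = T⁻¹` turns the equation `(B + T) x = y` into `(1 + K B) x = K y`. -/
theorem IsBoundedInverse.exists_vadd (hT : IsBoundedInverse T K) (hK : IsCompactOperator K)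
    (B : E →L[ℂ] E) (hker : ∀ x : T.domain, B x + T x = 0 → (x : E) = 0) :
    ∃ R, IsBoundedInverse ((B : E →ₗ[ℂ] E) +ᵥ T) R ∧ IsCompactOperator R := by
  have hunit : IsUnit (1 + K ∘L B) := by
    refine isUnit_one_add_of_isCompactOperator (hK.comp_clm B) fun x hx => ?_
    have hKx : K (-B x) = x := by
      rw [map_neg, neg_eq_iff_add_eq_zero, add_comm]
      exact hx
    obtain ⟨hxT, hTx⟩ := hT.exists_apply_eq hKx
    exact hker ⟨x, hxT⟩ (by rw [hTx, add_neg_cancel])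
  obtain ⟨u, hu⟩ := hunit
  let F : E ≃L[ℂ] E := ContinuousLinearEquiv.unitsEquiv ℂ E u
  have hF (x : E) : F x = x + K (B x) := congrArg (fun f : E →L[ℂ] E => f x) hu
  refine ⟨(F.symm : E →L[ℂ] E) ∘L K, ⟨fun x => ?_, fun y => ?_⟩, hK.clm_comp _⟩
  · change F.symm (K (B x + T x)) = x
    rw [F.symm_apply_eq, hF, map_add, hT.1, add_comm]
  · set x : E := F.symm (K y)
    have hFx : x + K (B x) = K y := by rw [← hF, F.apply_symm_apply]
    have hKx : K (y - B x) = x := by rw [map_sub, ← hFx, add_sub_cancel_right]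
    obtain ⟨hxT, hTx⟩ := hT.exists_apply_eq hKx
    refine ⟨hxT, ?_⟩
    change B x + T ⟨x, hxT⟩ = y
    rw [hTx, add_sub_cancel]

theorem IsBoundedInverse.exists_vadd_of_shift {μ : ℂ} (hT : IsBoundedInverse (shift T μ) K)
    (hK : IsCompactOperator K) (B : E →L[ℂ] E)
    (hker : ∀ x : T.domain, B x + T x = 0 → (x : E) = 0) :
    ∃ R, IsBoundedInverse ((B : E →ₗ[ℂ] E) +ᵥ T) R ∧ IsCompactOperator R := by
  have hshift : (B : E →ₗ[ℂ] E) +ᵥ T =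
      ((B + μ • ContinuousLinearMap.id ℂ E : E →L[ℂ] E) : E →ₗ[ℂ] E) +ᵥ shift T μ := by
    rw [shift_eq_vadd, vadd_vadd]
    exact congrArg (· +ᵥ T) (add_neg_cancel_right (B : E →ₗ[ℂ] E) _).symm
  rw [hshift]
  refine hT.exists_vadd hK _ fun x hx => hker x ?_
  change B x + μ • (x : E) + (T x - μ • (x : E)) = 0 at hx
  rwa [add_add_sub_cancel] at hx

theorem IsBoundedInverse.isEigenvalue_of_mem_operatorSpectrum (hT : IsBoundedInverse T K)
    (hK : IsCompactOperator K) {μ : ℂ} (hμ : μ ∈ operatorSpectrum T) : IsEigenvalue T μ := by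
  by_contra heigen
  have hker (x : T.domain) (hx : (-(μ • ContinuousLinearMap.id ℂ E)) x + T x = 0) :
      (x : E) = 0 := by
    by_contra hx0
    exact heigen ⟨x, hx0, (neg_add_eq_zero.1 hx).symm⟩
  obtain ⟨R, hR, -⟩ := hT.exists_vadd hK _ hker
  exact hμ ⟨R, by rw [shift_eq_vadd]; exact hR⟩

theorem IsBoundedInverse.finite_operatorSpectrum_inter_closedBall (hT : IsBoundedInverse T K)
    (hK : IsCompactOperator K) {r : ℝ} (hr : 0 < r) :
    (operatorSpectrum T ∩ Metric.closedBall 0 r).Finite := by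
  refine ((finite_setOf_hasEigenvalue_of_isCompactOperator (K := (K : E →ₗ[ℂ] E)) hK
    (inv_pos.2 hr)).preimage inv_injective.injOn).subset fun μ hμ => ?_
  obtain ⟨hμ0, heigen⟩ :=
    hT.ne_zero_and_hasEigenvalue_inv (hT.isEigenvalue_of_mem_operatorSpectrum hK hμ.1)
  refine ⟨heigen, ?_⟩
  rw [norm_inv]
  exact inv_anti₀ (norm_pos_iff.2 hμ0) (mem_closedBall_zero_iff.1 hμ.2)

theorem IsBoundedInverse.hasDiscreteSpectrum (hT : IsBoundedInverse T K)
    (hK : IsCompactOperator K) : HasDiscreteSpectrum T := by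
  have hfin {r : ℝ} (hr : 0 < r) := hT.finite_operatorSpectrum_inter_closedBall hK hr
  refine ⟨fun μ hμ => hT.isEigenvalue_of_mem_operatorSpectrum hK hμ, ?_, fun z hz => ?_⟩
  · refine (Set.countable_iUnion fun n : ℕ => (hfin n.cast_add_one_pos).countable).mono
      fun μ hμ => ?_
    obtain ⟨n, hn⟩ := exists_nat_ge ‖μ‖
    exact Set.mem_iUnion.2 ⟨n, hμ, mem_closedBall_zero_iff.2 (hn.trans (lt_add_one _).le)⟩
  · have hball : Metric.closedBall 0 (‖z‖ + 1) ∈ 𝓝 z :=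
      Metric.closedBall_mem_nhds_of_mem (mem_ball_zero_iff.2 (lt_add_one ‖z‖))
    refine Set.Infinite.of_accPt (hz.nhds_inter hball) ?_
    rw [Set.inter_comm]
    exact hfin (by positivity)

end LinearPMap

section Multiplication

open scoped ENNReal

variable {ι : Type*}

theorem hasSum_single_of_tendsto_norm_zero [DecidableEq ι] {E : ι → Type*}
    [∀ n, NormedAddCommGroup (E n)] {a : lp E ∞}
    (ha : Tendsto (fun n => ‖a n‖) cofinite (𝓝 0)) :
    HasSum (fun n => lp.single ∞ n (a n)) a := by
  refine Metric.tendsto_atTop.2 fun ε hε => ?_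
  have hfin : {n | ¬ ‖a n‖ < ε / 2}.Finite := ha.eventually_lt_const (half_pos hε)
  refine ⟨hfin.toFinset, fun s hs => ?_⟩
  rw [dist_comm, dist_eq_norm]
  refine (lp.norm_le_of_forall_le (half_pos hε).le fun n => ?_).trans_lt (half_lt_self hε)
  rw [lp.coeFn_sub, Pi.sub_apply, lp.coeFn_sum, Finset.sum_apply]
  simp only [lp.single_apply, Finset.sum_pi_single]
  split_ifs with hn
  · simpa using (half_pos hε).le
  · rw [sub_zero]
    by_contra hlt
    exact hn (hs (hfin.mem_toFinset.2 fun h => hlt h.le))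

variable {𝕜 : Type*} [RCLike 𝕜] {p : ℝ≥0∞} [Fact (1 ≤ p)]

variable (ι 𝕜 p) in
/-- The bounded operator of multiplication by a bounded sequence on `ℓ^p`, as a bounded linear
function of that sequence. -/
noncomputable def diagonal :
    lp (fun _ : ι => 𝕜) ∞ →L[𝕜] lp (fun _ : ι => 𝕜) p →L[𝕜] lp (fun _ : ι => 𝕜) p :=
  lp.holderL p (fun _ => ContinuousLinearMap.mul 𝕜 𝕜) (K := 1)
    fun _ => ContinuousLinearMap.opNorm_mul_le 𝕜 𝕜

theorem isCompactOperator_diagonal_single [DecidableEq ι] (n : ι) (c : 𝕜) :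
    IsCompactOperator (diagonal ι 𝕜 p (lp.single ∞ n c)) := by
  have hrank : diagonal ι 𝕜 p (lp.single ∞ n c) =
      lp.singleContinuousLinearMap 𝕜 (fun _ : ι => 𝕜) p n ∘L
        (c • lp.evalCLM 𝕜 (fun _ : ι => 𝕜) p n) := by
    refine ContinuousLinearMap.ext fun y => lp.ext (funext fun m => ?_)
    change (Pi.single n c : ι → 𝕜) m * y m = (Pi.single n (c * y n) : ι → 𝕜) m
    rcases eq_or_ne m n with rfl | hmn
    · rw [Pi.single_eq_same, Pi.single_eq_same]
    · rw [Pi.single_eq_of_ne hmn, Pi.single_eq_of_ne hmn, zero_mul]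
  have hfunctional : IsCompactOperator (c • lp.evalCLM 𝕜 (fun _ : ι => 𝕜) p n) :=
    isCompactOperator_of_locallyCompactSpace_dom (M₂ := 𝕜) _
  exact hrank ▸ hfunctional.clm_comp (lp.singleContinuousLinearMap 𝕜 (fun _ : ι => 𝕜) p n)

theorem isCompactOperator_diagonal {a : lp (fun _ : ι => 𝕜) ∞}
    (ha : Tendsto a cofinite (𝓝 0)) : IsCompactOperator (diagonal ι 𝕜 p a) := by
  classical
  have hsum : HasSum (fun n => diagonal ι 𝕜 p (lp.single ∞ n (a n))) (diagonal ι 𝕜 p a) :=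
    (hasSum_single_of_tendsto_norm_zero
      (tendsto_zero_iff_norm_tendsto_zero.1 ha)).mapL (diagonal ι 𝕜 p)
  refine isCompactOperator_of_tendsto hsum (Eventually.of_forall fun s => ?_)
  exact Submodule.sum_mem (compactOperator (RingHom.id 𝕜) (lp (fun _ : ι => 𝕜) p)
    (lp (fun _ : ι => 𝕜) p)) fun n _ => isCompactOperator_diagonal_single n (a n)

variable (p) in
/-- The operator of multiplication by an arbitrary sequence `a` on `ℓ^p`, with its maximal domain
of all `y ∈ ℓ^p` such that `a y ∈ ℓ^p`. -/
noncomputable def mulPMap (a : ι → 𝕜) : lp (fun _ : ι => 𝕜) p →ₗ.[𝕜] lp (fun _ : ι => 𝕜) p where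
  domain :=
    { carrier := {y | Memℓp (a * ⇑y) p}
      zero_mem' := by
        rw [Set.mem_ofPred_eq, lp.coeFn_zero, mul_zero]
        exact zero_memℓp
      add_mem' := fun {y z} hy hz => by
        rw [Set.mem_ofPred_eq, lp.coeFn_add, mul_add]
        exact hy.add hz
      smul_mem' := fun c y hy => by
        rw [Set.mem_ofPred_eq, lp.coeFn_smul, mul_smul_comm]
        exact hy.const_smul c }
  toFun :=
    { toFun := fun y => ⟨a * ⇑(y : lp (fun _ : ι => 𝕜) p), y.2⟩
      map_add' := fun y z => lp.ext (mul_add a _ _)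
      map_smul' := fun c y => lp.ext (mul_smul_comm c a _) }

theorem exists_isBoundedInverse_shift_mulPMap {a : ι → ℂ}
    (ha : Tendsto a cofinite (Bornology.cobounded ℂ)) {μ : ℂ} (hμ : ∀ n, a n ≠ μ) :
    ∃ K, IsBoundedInverse (shift (mulPMap p a) μ) K ∧ IsCompactOperator K := by
  have hb : Tendsto (fun n => (a n - μ)⁻¹) cofinite (𝓝 0) :=
    tendsto_inv₀_cobounded.comp ((tendsto_sub_const_cobounded μ).comp ha)
  let b : lp (fun _ : ι => ℂ) ∞ :=
    ⟨fun n => (a n - μ)⁻¹, memℓp_infty hb.norm.bddAbove_range_of_cofinite⟩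
  have hab (n : ι) : (a n - μ) * b n = 1 := mul_inv_cancel₀ (sub_ne_zero.2 (hμ n))
  refine ⟨diagonal ι ℂ p b, ⟨fun y => lp.ext (funext fun n => ?_), fun y => ?_⟩,
    isCompactOperator_diagonal hb⟩
  · change b n * (a n * (y : lp (fun _ : ι => ℂ) p) n - μ * (y : lp (fun _ : ι => ℂ) p) n) = _
    linear_combination (y : lp (fun _ : ι => ℂ) p) n * hab n
  · have hdom : a * ⇑(diagonal ι ℂ p b y) = ⇑(y + μ • diagonal ι ℂ p b y) := by
      funext n
      change a n * (b n * y n) = y n + μ * (b n * y n)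
      linear_combination y n * hab n
    refine ⟨show Memℓp _ p from hdom ▸ lp.memℓp _, lp.ext ?_⟩
    change a * ⇑(diagonal ι ℂ p b y) - μ • ⇑(diagonal ι ℂ p b y) = ⇑y
    rw [hdom, lp.coeFn_add, lp.coeFn_smul, add_sub_cancel_right]

end Multiplication

section SecondDifference

theorem continuous_of_forall_continuous_apply {ι 𝕜 E : Type*} {F : ι → Type*}
    {p : ENNReal} [Fact (1 ≤ p)] [NontriviallyNormedField 𝕜] [NormedAddCommGroup E]
    [NormedSpace 𝕜 E] [CompleteSpace E] [∀ n, NormedAddCommGroup (F n)] [∀ n, NormedSpace 𝕜 (F n)]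
    [∀ n, CompleteSpace (F n)] (f : E →ₗ[𝕜] lp F p) (hf : ∀ n, Continuous fun x => f x n) :
    Continuous f := by
  refine f.continuous_of_seq_closed_graph fun u x y hu hy => lp.ext (funext fun n => ?_)
  have hy_apply : Tendsto (fun k => f (u k) n) atTop (𝓝 (y n)) :=
    ((lp.evalCLM 𝕜 F p n).continuous.tendsto y).comp hy
  exact tendsto_nhds_unique hy_apply (((hf n).tendsto x).comp hu)

theorem continuous_extend (δ : ℝ) (n : ℤ) : Continuous fun y : l20 => extend δ y n := by
  have happly (m : Z0) : Continuous fun y : l20 => (y m : ℂ) :=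
    (lp.evalCLM ℂ (fun _ : Z0 => ℂ) 2 m).continuous
  unfold extend
  split_ifs
  · exact happly _
  · exact (happly _).add (continuous_const.mul ((happly _).sub (happly _)))
  · exact happly _

theorem mem_domL_zero (y : l20) : y ∈ domL 0 := by
  change Memℓp (fun n => ((0 : ℝ) : ℂ) * y n) 2
  simp only [Complex.ofReal_zero, zero_mul]
  exact zero_memℓp

/-- The bounded operator `(y_n) ↦ (-Δ² y_{n-1})` on `l_0²`, where `y_0` and `y_1` are determined
by the transition conditions. -/
noncomputable def negSecondDiff (δ : ℝ) : l20 →L[ℂ] l20 where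
  toLinearMap := (opL δ 0).toFun ∘ₗ LinearMap.id.codRestrict (domL 0) mem_domL_zero
  cont := by
    refine continuous_of_forall_continuous_apply _ fun n => ?_
    change Continuous fun y : l20 => diffExpr δ 0 y n
    simp only [diffExpr, fwdDiff, Pi.zero_apply, Complex.ofReal_zero, zero_mul, add_zero]
    exact (((continuous_extend δ _).sub (continuous_extend δ _)).sub
      ((continuous_extend δ _).sub (continuous_extend δ _))).neg

theorem diffExpr_eq_negSecondDiff_add (δ : ℝ) (q : Z0 → ℝ) (y : l20) (n : Z0) :
    diffExpr δ q y n = negSecondDiff δ y n + q n * y n := by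
  change diffExpr δ q y n = diffExpr δ 0 y n + q n * y n
  simp only [diffExpr, Pi.zero_apply, Complex.ofReal_zero, zero_mul, add_zero]

theorem opL_eq_vadd (δ : ℝ) (q : Z0 → ℝ) :
    opL δ q = (negSecondDiff δ : l20 →ₗ[ℂ] l20) +ᵥ mulPMap 2 (fun n => (q n : ℂ)) := by
  exact LinearPMap.ext rfl fun y _ _ => lp.ext (funext (diffExpr_eq_negSecondDiff_add δ q y))

end SecondDifference

section Flux

open scoped ComplexOrder

/-- The flux `ΔY_n · conj Y_n`, the boundary term of the summation by parts of
`Σ Δ²Y_{n-1} · conj Y_n`. -/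
noncomputable def flux (Y : ℤ → ℂ) (n : ℤ) : ℂ :=
  fwdDiff 1 Y n * starRingEnd ℂ (Y n)

theorem flux_sub_flux_sub_one (Y : ℤ → ℂ) (n : ℤ) :
    flux Y n - flux Y (n - 1) =
      fwdDiff 1 (fwdDiff 1 Y) (n - 1) * starRingEnd ℂ (Y n) + ‖fwdDiff 1 Y (n - 1)‖ ^ 2 := by
  rw [← Complex.mul_conj']
  simp only [flux, fwdDiff, sub_add_cancel, map_sub]
  ring

theorem tendsto_flux {Y : ℤ → ℂ} (hlim : Tendsto Y cofinite (𝓝 0)) :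
    Tendsto (flux Y) cofinite (𝓝 0) := by
  have hshift : Tendsto (fun n => Y (n + 1)) cofinite (𝓝 0) :=
    hlim.comp (add_left_injective (1 : ℤ)).tendsto_cofinite
  have hconj := (Complex.continuous_conj.tendsto 0).comp hlim
  have hflux := (hshift.sub hlim).mul hconj
  rwa [sub_zero, zero_mul] at hflux

theorem le_of_monotoneOn_Ici_of_tendsto_atTop {α β : Type*} [Preorder α] [IsDirectedOrder α]
    [Preorder β] [TopologicalSpace β] [OrderClosedTopology β] {g : α → β} {a : α} {l : β}
    (hg : MonotoneOn g (Set.Ici a)) (hlim : Tendsto g atTop (𝓝 l)) {n : α} (hn : a ≤ n) :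
    g n ≤ l :=
  have : Nonempty α := ⟨a⟩
  ge_of_tendsto hlim ((eventually_ge_atTop n).mono fun _ hm => hg hn (hn.trans hm) hm)

theorem ge_of_monotoneOn_Iic_of_tendsto_atBot {α β : Type*} [Preorder α] [IsCodirectedOrder α]
    [Preorder β] [TopologicalSpace β] [OrderClosedTopology β] {g : α → β} {a : α} {l : β}
    (hg : MonotoneOn g (Set.Iic a)) (hlim : Tendsto g atBot (𝓝 l)) {n : α} (hn : n ≤ a) :
    l ≤ g n :=
  le_of_monotoneOn_Ici_of_tendsto_atTop (α := αᵒᵈ) (β := βᵒᵈ) hg.dual hlim hn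

variable {q : Z0 → ℝ} {Y : ℤ → ℂ}

theorem flux_sub_one_add_le (hq : ∀ n, 0 ≤ q n)
    (hY : ∀ n : Z0, fwdDiff 1 (fwdDiff 1 Y) (n - 1) = q n * Y n) (n : Z0) :
    flux Y (n - 1) + ‖fwdDiff 1 Y (n - 1)‖ ^ 2 ≤ flux Y n := by
  have hpot : (0 : ℂ) ≤ q n * ‖Y n‖ ^ 2 := by exact_mod_cast mul_nonneg (hq n) (sq_nonneg _)
  rw [← sub_nonneg]
  convert hpot using 1
  have hid := flux_sub_flux_sub_one Y n
  rw [hY, mul_assoc, Complex.mul_conj'] at hid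
  linear_combination hid

theorem monotoneOn_flux (hq : ∀ n, 0 ≤ q n)
    (hY : ∀ n : Z0, fwdDiff 1 (fwdDiff 1 Y) (n - 1) = q n * Y n) :
    MonotoneOn (flux Y) (Set.Ici 1) ∧ MonotoneOn (flux Y) (Set.Iic (-1)) := by
  have hstep (n : Z0) : flux Y (n - 1) ≤ flux Y n :=
    (le_add_of_nonneg_right (by positivity)).trans (flux_sub_one_add_le hq hY n)
  refine ⟨monotoneOn_of_sub_one_le Set.ordConnected_Ici fun n _ _ hn => ?_,
    monotoneOn_of_sub_one_le Set.ordConnected_Iic fun n _ hn _ => ?_⟩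
  · rw [Set.mem_Ici] at hn
    exact hstep ⟨n, by omega⟩
  · rw [Set.mem_Iic] at hn
    exact hstep ⟨n, by omega⟩

theorem flux_nonpos_and_nonneg (hq : ∀ n, 0 ≤ q n)
    (hY : ∀ n : Z0, fwdDiff 1 (fwdDiff 1 Y) (n - 1) = q n * Y n)
    (hlim : Tendsto Y cofinite (𝓝 0)) :
    (∀ n, 1 ≤ n → flux Y n ≤ 0) ∧ ∀ n ≤ -1, 0 ≤ flux Y n := by
  obtain ⟨hright, hleft⟩ := monotoneOn_flux hq hY
  have hflux := tendsto_flux hlim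
  rw [Int.cofinite_eq, tendsto_sup] at hflux
  exact ⟨fun n hn => le_of_monotoneOn_Ici_of_tendsto_atTop hright hflux.2 hn,
    fun n hn => ge_of_monotoneOn_Iic_of_tendsto_atBot hleft hflux.1 hn⟩

theorem flux_eq_zero (hq : ∀ n, 0 ≤ q n)
    (hY : ∀ n : Z0, fwdDiff 1 (fwdDiff 1 Y) (n - 1) = q n * Y n)
    (hlim : Tendsto Y cofinite (𝓝 0)) (hone : flux Y 1 = 0) (hneg_one : flux Y (-1) = 0)
    {n : ℤ} (hn : n ≠ 0) : flux Y n = 0 := by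
  obtain ⟨hright, hleft⟩ := monotoneOn_flux hq hY
  obtain ⟨hnonpos, hnonneg⟩ := flux_nonpos_and_nonneg hq hY hlim
  rcases hn.lt_or_gt with hneg | hpos
  · have hn1 : n ≤ -1 := Int.le_sub_one_of_lt hneg
    exact ((hleft hn1 Set.self_mem_Iic hn1).trans_eq hneg_one).antisymm (hnonneg n hn1)
  · exact (hnonpos n hpos).antisymm (hone.symm.trans_le (hright Set.self_mem_Ici hpos hpos))

theorem eq_zero_of_flux_eq_zero (hq : ∀ n, 0 ≤ q n)
    (hY : ∀ n : Z0, fwdDiff 1 (fwdDiff 1 Y) (n - 1) = q n * Y n)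
    (hlim : Tendsto Y cofinite (𝓝 0)) (hflux : ∀ n, n ≠ 0 → flux Y n = 0) (n : Z0) :
    Y n = 0 := by
  have hconst (m : ℤ) (hm : m ≠ 0 ∧ m ≠ 1) : ‖Y m‖ = ‖Y (m - 1)‖ := by
    have hle := flux_sub_one_add_le hq hY ⟨m, hm⟩
    rw [hflux _ (sub_ne_zero.2 hm.2), hflux _ hm.1, zero_add] at hle
    have hdiff : fwdDiff 1 Y (m - 1) = 0 := by
      rw [← norm_eq_zero, ← sq_nonpos_iff]
      exact_mod_cast hle
    rw [fwdDiff, sub_add_cancel, sub_eq_zero] at hdiff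
    rw [hdiff]
  have hlim_norm := tendsto_zero_iff_norm_tendsto_zero.1 hlim
  rw [Int.cofinite_eq, tendsto_sup] at hlim_norm
  have hright : MonotoneOn (fun m => ‖Y m‖) (Set.Ici 1) :=
    monotoneOn_of_sub_one_le Set.ordConnected_Ici fun m _ _ hm =>
      (hconst m (by rw [Set.mem_Ici] at hm; omega)).ge
  have hleft : MonotoneOn (fun m => -‖Y m‖) (Set.Iic (-1)) :=
    monotoneOn_of_sub_one_le Set.ordConnected_Iic fun m _ hm _ =>
      neg_le_neg (hconst m (by rw [Set.mem_Iic] at hm; omega)).le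
  rw [← norm_le_zero_iff]
  rcases le_or_gt 1 (n : ℤ) with hn | hn
  · exact le_of_monotoneOn_Ici_of_tendsto_atTop hright hlim_norm.2 hn
  · rw [← neg_nonneg]
    refine ge_of_monotoneOn_Iic_of_tendsto_atBot hleft (neg_zero (G := ℝ) ▸ hlim_norm.1.neg) ?_
    have := n.2.1
    omega

theorem norm_phase (δ : ℝ) : ‖phase δ‖ = 1 := by
  simp [phase, Complex.norm_exp]

theorem one_add_phase (δ : ℝ) :
    1 + phase δ = 2 * Real.cos δ * Complex.exp (δ * Complex.I) := by
  rw [Complex.ofReal_cos, Complex.two_cos, add_mul, ← Complex.exp_add, ← Complex.exp_add, neg_mul,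
    neg_add_cancel, Complex.exp_zero, add_comm, phase]
  ring_nf

theorem eq_zero_of_phase_mul_nonneg {δ : ℝ} (hδ : Real.cos δ ≠ 0) {z : ℂ} (hz : z ≤ 0)
    (hphase : 0 ≤ phase δ * z) : z = 0 := by
  have hneg : -z = ‖z‖ := by
    rw [← norm_neg]
    exact Complex.eq_coe_norm_of_nonneg (neg_nonneg.2 hz)
  have hmul : phase δ * z = ‖z‖ := by
    rw [Complex.eq_coe_norm_of_nonneg hphase, norm_mul, norm_phase, one_mul]
  have hsum : (1 + phase δ) * z = 0 := by linear_combination hmul - hneg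
  refine (mul_eq_zero.1 hsum).resolve_left ?_
  rw [one_add_phase]
  exact mul_ne_zero (mul_ne_zero two_ne_zero (Complex.ofReal_ne_zero.2 hδ)) (Complex.exp_ne_zero _)

theorem flux_extend_neg_one (δ : ℝ) (y : Z0 → ℂ) :
    flux (extend δ y) (-1) = phase δ * flux (extend δ y) 1 := by
  obtain ⟨-, hvalue, hslope⟩ := (extend_unique δ y _).2 rfl
  rw [flux, flux, hslope, hvalue, phase, mul_assoc]

theorem tendsto_extend_cofinite (δ : ℝ) (y : l20) :
    Tendsto (extend δ y) cofinite (𝓝 0) := by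
  have hsummable := (memℓp_two_iff _).1 (extend_memℓp δ (lp.memℓp y))
  have hsqrt := hsummable.tendsto_cofinite_zero.sqrt
  simp only [Real.sqrt_zero, Real.sqrt_sq (norm_nonneg _)] at hsqrt
  exact tendsto_zero_iff_norm_tendsto_zero.2 hsqrt

theorem eq_zero_of_diffExpr_eq_zero {δ : ℝ} (hδ : Real.cos δ ≠ 0) (hq : ∀ n, 0 ≤ q n) {y : l20}
    (hy : ∀ n, diffExpr δ q y n = 0) : y = 0 := by
  have hyY := ((extend_unique δ y _).2 rfl).1
  have heq (n : Z0) : fwdDiff 1 (fwdDiff 1 (extend δ y)) (n - 1) = q n * extend δ y n := by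
    rw [hyY, ← sub_eq_zero, ← neg_eq_zero, ← hy n, diffExpr]
    ring
  have hlim := tendsto_extend_cofinite δ y
  obtain ⟨hnonpos, hnonneg⟩ := flux_nonpos_and_nonneg hq heq hlim
  have hone : flux (extend δ y) 1 = 0 :=
    eq_zero_of_phase_mul_nonneg hδ (hnonpos 1 le_rfl)
      (flux_extend_neg_one δ y ▸ hnonneg (-1) le_rfl)
  have hneg_one : flux (extend δ y) (-1) = 0 := by rw [flux_extend_neg_one, hone, mul_zero]
  refine lp.ext (funext fun n => (hyY n).symm.trans ?_)
  exact eq_zero_of_flux_eq_zero hq heq hlim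
    (fun m hm => flux_eq_zero hq heq hlim hone hneg_one hm) n

end Flux

section Inverse

theorem tendsto_ofReal_cobounded {q : Z0 → ℝ}
    (hq : Tendsto q (comap (fun n : Z0 => |(n : ℤ)|) atTop) atTop) :
    Tendsto (fun n => (q n : ℂ)) cofinite (Bornology.cobounded ℂ) := by
  have habs : Tendsto (fun n : ℤ => |n|) cofinite atTop := by
    rw [Int.cofinite_eq]
    exact tendsto_abs_atBot_atTop.sup tendsto_abs_atTop_atTop
  have hq_cofinite : Tendsto q cofinite atTop :=
    hq.comp (tendsto_iff_comap.1 (habs.comp Subtype.val_injective.tendsto_cofinite))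
  rw [← tendsto_norm_atTop_iff_cobounded]
  simp only [Complex.norm_real]
  exact tendsto_norm_atTop_atTop.comp hq_cofinite

theorem exists_isBoundedInverse_opL {δ : ℝ} (hδ : Real.cos δ ≠ 0) {q : Z0 → ℝ}
    (hq0 : ∀ n, 0 ≤ q n) (hq : Tendsto q (comap (fun n : Z0 => |(n : ℤ)|) atTop) atTop) :
    ∃ Linv : l20 →L[ℂ] l20, IsBoundedInverse (opL δ q) Linv ∧ IsCompactOperator Linv := by
  have hq_ne (n : Z0) : (q n : ℂ) ≠ -1 := by
    exact_mod_cast (neg_one_lt_zero.trans_le (hq0 n)).ne'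
  obtain ⟨K, hK, hKc⟩ :=
    exists_isBoundedInverse_shift_mulPMap (p := 2) (tendsto_ofReal_cobounded hq) hq_ne
  rw [opL_eq_vadd]
  refine hK.exists_vadd_of_shift hKc _ fun y hy => eq_zero_of_diffExpr_eq_zero hδ hq0 fun n => ?_
  rw [diffExpr_eq_negSecondDiff_add]
  exact congrArg (fun z : l20 => z n) hy

theorem isBoundedInverse_opA {δ : ℝ} {q : Z0 → ℝ} {B : l20 →L[ℂ] l20}
    (hB : IsBoundedInverse (opL δ q) B) :
    IsBoundedInverse (opA δ q) (B ∘L (opM δ : l20 →L[ℂ] l20)) := by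
  refine ⟨fun y => ?_, fun f => ?_⟩
  · change B (opM δ ((opM δ).symm (opL δ q y))) = y
    rw [LinearIsometryEquiv.apply_symm_apply]
    exact hB.1 y
  · obtain ⟨hdom, hf⟩ := hB.2 (opM δ f)
    refine ⟨hdom, ?_⟩
    change (opM δ).symm (opL δ q ⟨B (opM δ f), hdom⟩) = f
    rw [hf, LinearIsometryEquiv.symm_apply_apply]

end Inverse

end DiscreteNonHermitian

theorem corollary7p2_general (δ : ℝ) (hδ : Real.cos δ ≠ 0) (q : Z0 → ℝ) (hq0 : ∀ n, 0 ≤ q n)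
    (hq : Tendsto q (comap (fun n : Z0 => |(n : ℤ)|) atTop) atTop) :
    (∃ Linv : l20 →L[ℂ] l20,
      IsBoundedInverse (opL δ q) Linv ∧
      IsBoundedInverse (opA δ q) (Linv ∘L (opM δ : l20 →L[ℂ] l20)) ∧
      IsCompactOperator (Linv ∘L (opM δ : l20 →L[ℂ] l20))) ∧
    HasDiscreteSpectrum (opA δ q) := by
  obtain ⟨Linv, hL, hL_compact⟩ := exists_isBoundedInverse_opL hδ hq0 hq
  have hA := isBoundedInverse_opA hL
  have hA_compact : IsCompactOperator (Linv ∘L (opM δ : l20 →L[ℂ] l20)) :=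
    hL_compact.comp_clm (opM δ : l20 →L[ℂ] l20)
  exact ⟨⟨Linv, hL, hA, hA_compact⟩, hA.hasDiscreteSpectrum hA_compact⟩

theorem corollary7p2 (δ : ℝ) (hδ : δ ∈ Set.Ico 0 (Real.pi / 2))
    (q : Z0 → ℝ) (c : ℝ) (hc : 0 < c) (hqc : ∀ n, c ≤ q n)
    (hq : Tendsto q (comap (fun n : Z0 => |(n : ℤ)|) atTop) atTop) :
    (∃ Linv : l20 →L[ℂ] l20,
      IsBoundedInverse (opL δ q) Linv ∧
      IsBoundedInverse (opA δ q) (Linv ∘L (opM δ : l20 →L[ℂ] l20)) ∧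
      IsCompactOperator (Linv ∘L (opM δ : l20 →L[ℂ] l20))) ∧
    HasDiscreteSpectrum (opA δ q) :=
  corollary7p2_general δ (Real.cos_pos_of_mem_Ioo ⟨by linarith [hδ.1, Real.pi_pos], hδ.2⟩).ne' q
    (fun n => hc.le.trans (hqc n)) hq
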